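/- Let $f_1:\mathbb{R}^{n_1}\to\mathbb{R}^{n_1}$, $f_2:\mathbb{R}^{n_2}\to\mathbb{R}^{n_2}$ and $g:\mathbb{R}^{n_1}\times\mathbb{R}^{n_2}\to\mathbb{R}^{n_1}$ be locally Lipschitz, and consider the cascade $$\dot x_1=f_1(x_1)+g(x_1,x_2),\qquad \dot x_2=f_2(x_2),\qquad (x_1,x_2)\in\mathbb{R}^{n_1}\times\mathbb{R}^{n_2}.\tag{1}$$ Suppose that the origin of $\dot x_1=f_1(x_1)$ is globally exponentially stable and that, for some constant $M>0$, $\|g(x_1,x_2)\|\le M\|x_2\|$ for all $x_1,x_2$. Then: 1. If the origin of $\dot x_2=f_2(x_2)$ is asymptotically stable, then the origin of (1) is asymptotically stable. 2. If moreover $f_1$ is globally Lipschitz, and the origin of $\dot x_2=f_2(x_2)$ is globally asymptotically stable, then the origin of (1) is globally asymptotically stable. 3. If moreover $f_1$ is globally Lipschitz, and the origin of $\dot x_2=f_2(x_2)$ is globally exponentially stable, then the origin of (1) is globally exponentially stable. Here $\|\cdot\|$ is the Euclidean norm, and for a system $\dot x=f(x)$ the origin is: *stable* if for every $\varepsilon>0$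 there is $\delta>0$ such that every solution with $\|x(0)\|<\delta$ exists for all $t\ge 0$ and satisfies $\|x(t)\|<\varepsilon$ for all $t\ge0$; *asymptotically stable* if it is stable and there is $\delta>0$ such that $x(t)\to0$ as $t\to\infty$ whenever $\|x(0)\|<\delta$; *globally asymptotically stable* if it is stable and every solution exists for all $t\ge0$ and tends to $0$; *globally exponentially stable* if every solution exists for all $t\ge0$ and there are $k,\lambda>0$ with $\|x(t)\|\le k\|x(0)\|e^{-\lambda t}$ for all solutions and all $t\ge0$. -/

import Mathlib

open Set Filter Topology

section Stability

variable {E : Type*} [NormedAddCommGroup E] [NormedSpace ℝ E]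

/-- `x` is a solution on `[0, ∞)` of the autonomous system `ẋ = f(x)`
(at `t = 0` the derivative is the right derivative). -/
def IsForwardSolution (f : E → E) (x : ℝ → E) : Prop :=
  IsIntegralCurveOn x (fun _ => f) (Ici 0)

/-- The origin is a (Lyapunov) stable equilibrium of `ẋ = f(x)`: solutions that start close enough
to the origin exist for all `t ≥ 0` and stay as close to the origin as desired.
(Taking `x₀ = 0` one sees that this contains `f 0 = 0`.) -/
def IsStableAtOrigin (f : E → E) : Prop :=
  ∀ ε > 0, ∃ δ > 0, ∀ x₀ : E, ‖x₀‖ < δ →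
    (∃ x : ℝ → E, IsForwardSolution f x ∧ x 0 = x₀) ∧
    ∀ x : ℝ → E, IsForwardSolution f x → x 0 = x₀ → ∀ t, 0 ≤ t → ‖x t‖ < ε

/-- The origin is an asymptotically stable equilibrium of `ẋ = f(x)`: it is stable and attracts
all solutions that start in some neighbourhood of it. -/
def IsAsympStableAtOrigin (f : E → E) : Prop :=
  IsStableAtOrigin f ∧
    ∃ δ > 0, ∀ x : ℝ → E, IsForwardSolution f x → ‖x 0‖ < δ → Tendsto x atTop (𝓝 0)

/-- The origin is a globally asymptotically stable equilibrium of `ẋ = f(x)`: it is stable, and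
every initial state has a solution on `[0, ∞)` and all solutions tend to the origin. -/
def IsGloballyAsympStableAtOrigin (f : E → E) : Prop :=
  IsStableAtOrigin f ∧
    (∀ x₀ : E, ∃ x : ℝ → E, IsForwardSolution f x ∧ x 0 = x₀) ∧
    ∀ x : ℝ → E, IsForwardSolution f x → Tendsto x atTop (𝓝 0)

/-- The origin is a globally exponentially stable equilibrium of `ẋ = f(x)`: every initial state
has a solution on `[0, ∞)`, and `‖x(t)‖ ≤ k ‖x(0)‖ exp(-lam t)` for all solutions and all `t ≥ 0`,
with constants `k, lam > 0`. -/
def IsGloballyExpStableAtOrigin (f : E → E) : Prop :=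
  (∀ x₀ : E, ∃ x : ℝ → E, IsForwardSolution f x ∧ x 0 = x₀) ∧
    ∃ k > 0, ∃ lam > 0, ∀ x : ℝ → E, IsForwardSolution f x →
      ∀ t, 0 ≤ t → ‖x t‖ ≤ k * ‖x 0‖ * Real.exp (-lam * t)

end Stability

/-- State space of the cascade: stacked vectors `col(x₁, x₂)`, with the Euclidean norm
`‖col(x₁, x₂)‖² = ‖x₁‖² + ‖x₂‖²`. -/
abbrev CascadeState (n₁ n₂ : ℕ) : Type :=
  WithLp 2 (EuclideanSpace ℝ (Fin n₁) × EuclideanSpace ℝ (Fin n₂))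

/-- Right-hand side of the cascade `ẋ₁ = f₁(x₁) + g(x₁, x₂)`, `ẋ₂ = f₂(x₂)`. -/
def cascadeField {n₁ n₂ : ℕ}
    (f₁ : EuclideanSpace ℝ (Fin n₁) → EuclideanSpace ℝ (Fin n₁))
    (f₂ : EuclideanSpace ℝ (Fin n₂) → EuclideanSpace ℝ (Fin n₂))
    (g : EuclideanSpace ℝ (Fin n₁) → EuclideanSpace ℝ (Fin n₂) → EuclideanSpace ℝ (Fin n₁)) :
    CascadeState n₁ n₂ → CascadeState n₁ n₂ :=
  fun x => WithLp.toLp 2 (f₁ x.fst + g x.fst x.snd, f₂ x.snd)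

/-! The subsystem `ẋ₁ = f₁(x₁) + u` is exponentially input-to-state stable, and this needs no
Lyapunov function. Over a window of length `T`, compare the perturbed trajectory with the
unperturbed one from the same point: the latter shrinks by a factor 1/2, and Grönwall bounds the
difference by `C * ε` when `‖u‖ ≤ ε`. Iterating over windows gives `exists_iss_bound`: exponential
decay plus a multiple of `ε`, wherever `f₁` is Lipschitz.

In the cascade `x₂` evolves on its own and `u = g(x₁, x₂)` is at most `M * ‖x₂‖`. Stability follows
by a first-exit argument in the unit ball, attraction by restarting the bound at a late time,
exponential decay by restarting it at `t / 2`. Forward existence comes from a priori bounds, which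
exclude blow-up. -/

/-! ### Uniqueness and global existence for locally Lipschitz fields -/

section ODE

/-- A continuous function that cannot reach the level `R` for the first time stays below it. -/
theorem forall_lt_of_no_first_exit {φ : ℝ → ℝ} {τ R : ℝ} (hφ : ContinuousOn φ (Icc 0 τ))
    (h0 : φ 0 < R) (h : ∀ σ ∈ Icc 0 τ, (∀ t ∈ Icc 0 σ, φ t ≤ R) → φ σ < R) :
    ∀ t ∈ Icc 0 τ, φ t < R := by
  by_contra! hne
  obtain ⟨t₁, ht₁, hlt⟩ := hne
  let S : Set ℝ := Icc 0 τ ∩ φ ⁻¹' Ici R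
  have hS : IsClosed S := hφ.preimage_isClosed_of_isClosed isClosed_Icc isClosed_Ici
  have hSb : BddBelow S := ⟨0, fun t ht => ht.1.1⟩
  have hmem : sInf S ∈ S := hS.csInf_mem ⟨t₁, ht₁, hlt⟩ hSb
  have hbelow : ∀ t ∈ Ico 0 (sInf S), φ t < R := by
    intro t ht
    by_contra! hge
    exact notMem_of_lt_csInf ht.2 hSb ⟨⟨ht.1, ht.2.le.trans hmem.1.2⟩, hge⟩
  have hpos : 0 < sInf S := hmem.1.1.lt_of_ne fun h' => (h' ▸ h0).not_ge hmem.2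
  have hcont : ContinuousOn φ (Icc 0 (sInf S)) := hφ.mono (Icc_subset_Icc_right hmem.1.2)
  refine (h _ hmem.1 fun t ht => ?_).not_ge hmem.2
  rw [← closure_Ico hpos.ne] at ht hcont
  exact le_on_closure (fun t ht => (hbelow t ht).le) hcont continuousOn_const ht

open Metric
open scoped NNReal

variable {E : Type*} [NormedAddCommGroup E]

theorem LocallyLipschitz.exists_lipschitzOnWith_closedBall [ProperSpace E] {F : Type*}
    [NormedAddCommGroup F] {f : E → F} (hf : LocallyLipschitz f) (c : E) (R : ℝ) :
    ∃ K : ℝ≥0, LipschitzOnWith K f (closedBall c R) :=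
  LocallyLipschitzOn.exists_lipschitzOnWith_of_compact (isCompact_closedBall c R)
    hf.locallyLipschitzOn

variable [NormedSpace ℝ E]

theorem IsIntegralCurveOn.exists_norm_le_Icc {f : E → E} {x : ℝ → E} {a b : ℝ}
    (hx : IsIntegralCurveOn x (fun _ => f) (Icc a b)) :
    ∃ R, ∀ t ∈ Icc a b, ‖x t‖ ≤ R :=
  isCompact_Icc.exists_bound_of_continuousOn hx.continuousOn

/-- Derivatives of an integral curve on `[a, b]` are right derivatives on `[a, b)`. -/
theorem HasDerivWithinAt.Ici_of_Icc {x : ℝ → E} {v : E} {a b t : ℝ} (ht : t ∈ Ico a b)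
    (hx : HasDerivWithinAt x v (Icc a b) t) : HasDerivWithinAt x v (Ici t) t :=
  hx.mono_of_mem_nhdsWithin
    (mem_of_superset (Icc_mem_nhdsGE ht.2) (Icc_subset_Icc_left ht.1))

theorem IsIntegralCurveOn.eqOn_Icc_of_locallyLipschitz [ProperSpace E] {f : E → E}
    (hf : LocallyLipschitz f) {x y : ℝ → E} {a b : ℝ}
    (hx : IsIntegralCurveOn x (fun _ => f) (Icc a b))
    (hy : IsIntegralCurveOn y (fun _ => f) (Icc a b)) (h : x a = y a) :
    EqOn x y (Icc a b) := by
  obtain ⟨R₁, hR₁⟩ := hx.exists_norm_le_Icc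
  obtain ⟨R₂, hR₂⟩ := hy.exists_norm_le_Icc
  obtain ⟨K, hK⟩ := hf.exists_lipschitzOnWith_closedBall 0 (max R₁ R₂)
  refine ODE_solution_unique_of_mem_Icc_right (v := fun _ => f)
    (s := fun _ => closedBall 0 (max R₁ R₂)) (K := K) (fun _ _ => hK) hx.continuousOn
    (fun t ht => (hx t (Ico_subset_Icc_self ht)).Ici_of_Icc ht) (fun t ht => ?_) hy.continuousOn
    (fun t ht => (hy t (Ico_subset_Icc_self ht)).Ici_of_Icc ht) (fun t ht => ?_) h
  · exact mem_closedBall_zero_iff.2 ((hR₁ t (Ico_subset_Icc_self ht)).trans (le_max_left _ _))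
  · exact mem_closedBall_zero_iff.2 ((hR₂ t (Ico_subset_Icc_self ht)).trans (le_max_right _ _))

variable [FiniteDimensional ℝ E]

/-- With speed at most `C`, a curve stays within `C * T` of `x₀`, so Picard–Lindelöf on that ball
covers all of `[0, T]` at once. -/
theorem exists_isIntegralCurveOn_Icc_of_bounded {f : E → E} (hf : LocallyLipschitz f) {C : ℝ}
    (hC : ∀ x, ‖f x‖ ≤ C) (x₀ : E) {T : ℝ} (hT : 0 ≤ T) :
    ∃ x : ℝ → E, IsIntegralCurveOn x (fun _ => f) (Icc 0 T) ∧ x 0 = x₀ := by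
  have : ProperSpace E := FiniteDimensional.proper ℝ E
  have : CompleteSpace E := FiniteDimensional.complete ℝ E
  have hC0 : 0 ≤ C := (norm_nonneg _).trans (hC 0)
  lift C to ℝ≥0 using hC0
  lift T to ℝ≥0 using hT
  obtain ⟨K, hK⟩ := hf.exists_lipschitzOnWith_closedBall x₀ (C * T : ℝ≥0)
  have hPL : IsPicardLindelof (fun _ : ℝ => f) (⟨0, le_rfl, T.2⟩ : Icc (0 : ℝ) T) x₀ (C * T) 0 C K :=
    .of_time_independent (fun x _ => hC x) hK (by simp)
  obtain ⟨x, hx0, hx⟩ := hPL.exists_eq_forall_mem_Icc_hasDerivWithinAt₀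
  exact ⟨x, hx, hx0⟩

/-- If all solutions on `[0, T]` starting at `x₀` are bounded by `R`, there is a solution
on `[0, T]`. -/
theorem exists_isIntegralCurveOn_Icc_of_apriori_bound {f : E → E} (hf : LocallyLipschitz f)
    {x₀ : E} {T R : ℝ} (hT : 0 ≤ T)
    (hR : ∀ τ ∈ Icc 0 T, ∀ x : ℝ → E, IsIntegralCurveOn x (fun _ => f) (Icc 0 τ) → x 0 = x₀ →
      ‖x τ‖ ≤ R) :
    ∃ x : ℝ → E, IsIntegralCurveOn x (fun _ => f) (Icc 0 T) ∧ x 0 = x₀ := by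
  have : ProperSpace E := FiniteDimensional.proper ℝ E
  have hx₀ : ‖x₀‖ ≤ R := by
    -- On the degenerate interval `[0, 0]` every curve is an integral curve.
    refine hR 0 ⟨le_rfl, hT⟩ (fun _ => x₀) (fun t ht => ?_) rfl
    exact HasFDerivWithinAt.of_subsingleton (by simp)
  have hR0 : 0 ≤ R := (norm_nonneg _).trans hx₀
  -- The truncated field `f (φ x • x)` is bounded and equals `f` on the ball of radius `R + 1`; the
  -- margin 1 over `R` prevents a first exit.
  let φ : ContDiffBump (0 : E) := ⟨R + 1, R + 2, by linarith, by linarith⟩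
  have hP : LocallyLipschitz (fun x : E => φ x • x) :=
    ((φ.contDiff (n := 1)).smul contDiff_id).locallyLipschitz
  have hPb : ∀ x : E, φ x • x ∈ closedBall (0 : E) (R + 2) := by
    intro x
    rw [mem_closedBall_zero_iff, norm_smul, Real.norm_of_nonneg φ.nonneg]
    by_cases hx : ‖x‖ < R + 2
    · nlinarith [φ.le_one (x := x), φ.nonneg (x := x), norm_nonneg x]
    · rw [φ.zero_of_le_dist (by simpa using hx)]
      linarith
  obtain ⟨C, hC⟩ := (isCompact_closedBall (0 : E) (R + 2)).exists_bound_of_continuousOn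
    hf.continuous.continuousOn
  obtain ⟨x, hx, hx0⟩ := exists_isIntegralCurveOn_Icc_of_bounded (hf.comp hP)
    (fun y => hC _ (hPb y)) x₀ hT
  have key : ∀ τ ∈ Icc 0 T, (∀ t ∈ Icc 0 τ, ‖x t‖ ≤ R + 1) →
      IsIntegralCurveOn x (fun _ => f) (Icc 0 τ) := by
    intro τ hτ hb t ht
    have h := (hx t ⟨ht.1, ht.2.trans hτ.2⟩).mono (Icc_subset_Icc_right hτ.2)
    have h1 : φ (x t) = 1 := φ.one_of_mem_closedBall (by simpa using hb t ht)
    simpa [h1] using h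
  have hlt := forall_lt_of_no_first_exit (R := R + 1) hx.continuousOn.norm
    (by rw [hx0]; linarith) (fun σ hσ hb => by linarith [hR σ hσ x (key σ hσ hb) hx0])
  exact ⟨x, key T ⟨hT, le_rfl⟩ fun t ht => (hlt t ht).le, hx0⟩

/-- Solutions on `[0, n]` agree by uniqueness and can be glued. -/
theorem exists_isForwardSolution_of_apriori_bound {f : E → E} (hf : LocallyLipschitz f) {x₀ : E}
    (hR : ∀ T, 0 ≤ T → ∃ R, ∀ τ ∈ Icc 0 T, ∀ x : ℝ → E,
      IsIntegralCurveOn x (fun _ => f) (Icc 0 τ) → x 0 = x₀ → ‖x τ‖ ≤ R) :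
    ∃ x : ℝ → E, IsForwardSolution f x ∧ x 0 = x₀ := by
  have : ProperSpace E := FiniteDimensional.proper ℝ E
  have hex : ∀ n : ℕ, ∃ x : ℝ → E, IsIntegralCurveOn x (fun _ => f) (Icc 0 n) ∧ x 0 = x₀ := by
    intro n
    obtain ⟨R, hR⟩ := hR n n.cast_nonneg
    exact exists_isIntegralCurveOn_Icc_of_apriori_bound hf n.cast_nonneg hR
  choose X hX hX0 using hex
  have hmono : ∀ m n : ℕ, m ≤ n → EqOn (X m) (X n) (Icc 0 m) := fun m n hmn =>
    (hX m).eqOn_Icc_of_locallyLipschitz hf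
      ((hX n).mono (Icc_subset_Icc_right (by exact_mod_cast hmn))) ((hX0 m).trans (hX0 n).symm)
  have heq : ∀ n : ℕ, EqOn (fun t => X (⌊t⌋₊ + 1) t) (X n) (Ico 0 n) := by
    intro n t ht
    refine hmono _ n ?_ ⟨ht.1, by exact_mod_cast (Nat.lt_floor_add_one t).le⟩
    exact (Nat.floor_lt ht.1).2 ht.2
  -- The `+ 1` puts `t` strictly inside the interval, so one `X n` represents the glued curve near
  -- `t`.
  refine ⟨fun t => X (⌊t⌋₊ + 1) t, fun t ht => ?_, hX0 _⟩
  rw [mem_Ici] at ht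
  have hlt : t < ((⌊t⌋₊ + 1 : ℕ) : ℝ) := by exact_mod_cast Nat.lt_floor_add_one t
  have h := (hX (⌊t⌋₊ + 1) t ⟨ht, hlt.le⟩).mono Ico_subset_Icc_self
  have h' := h.congr (heq _) rfl
  refine h'.mono_of_mem_nhdsWithin ?_
  rw [← Ici_inter_Iio]
  exact inter_mem_nhdsWithin _ (Iio_mem_nhds hlt)

end ODE

/-! ### Exponential input-to-state stability -/

section ISS

open Metric
open scoped NNReal

theorem gronwallBound_zero_le {L ε t T : ℝ} (hL : 1 ≤ L) (hε : 0 ≤ ε) (ht : t ≤ T) :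
    gronwallBound 0 L ε t ≤ Real.exp (L * T) * ε := by
  have hL0 : 0 < L := by linarith
  rw [gronwallBound_of_K_ne_0 hL0.ne']
  have h1 : ε / L ≤ ε := div_le_self hε hL
  have h2 : Real.exp (L * t) ≤ Real.exp (L * T) := Real.exp_le_exp.2 (by gcongr)
  have h3 : 0 ≤ ε / L := by positivity
  nlinarith [Real.exp_pos (L * T)]

variable {E : Type*} [NormedAddCommGroup E] [NormedSpace ℝ E]

/-- Comparison of a solution of `ẋ = f(x) + u` with the solution of `ẏ = f(y)` that starts at the
same point. -/
theorem dist_le_of_perturbed_trajectory {f : E → E} {L : ℝ≥0} (hL : 1 ≤ L) {s : Set E}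
    (hf : LipschitzOnWith L f s) {x y u : ℝ → E} {a c T ε : ℝ} (hcT : c - a ≤ T)
    (hε : 0 ≤ ε) (hx : ∀ t ∈ Icc a c, HasDerivWithinAt x (f (x t) + u t) (Icc a c) t)
    (hu : ∀ t ∈ Icc a c, ‖u t‖ ≤ ε) (hxs : ∀ t ∈ Icc a c, x t ∈ s)
    (hy : IsForwardSolution f y) (hys : ∀ t, 0 ≤ t → y t ∈ s) (hy0 : y 0 = x a) :
    ∀ t ∈ Icc a c, ‖x t - y (t - a)‖ ≤ Real.exp (L * T) * ε := by
  have hy' : IsIntegralCurveOn (fun t => y (t - a)) (fun _ => f) (Ici a) := by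
    intro t ht
    have h := (hy (t - a) (mem_Ici.2 (sub_nonneg.2 ht))).scomp t
      (((hasDerivAt_id t).sub_const a).hasDerivWithinAt (s := Ici a))
      (fun r hr => mem_Ici.2 (sub_nonneg.2 hr))
    simpa [Function.comp_def] using h
  intro t ht
  have h := dist_le_of_approx_trajectories_ODE_of_mem (v := fun _ => f) (s := fun _ => s) (K := L)
    (f' := fun t => f (x t) + u t) (g' := fun t => f (y (t - a))) (εf := ε) (εg := 0) (δ := 0)
    (a := a) (b := c) (f := x) (g := fun t => y (t - a))
    (fun _ _ => hf) (fun t ht => (hx t ht).continuousWithinAt)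
    (fun t ht => (hx t (Ico_subset_Icc_self ht)).Ici_of_Icc ht)
    (fun t ht => by simpa using hu t (Ico_subset_Icc_self ht))
    (fun t ht => hxs t (Ico_subset_Icc_self ht))
    (hy'.continuousOn.mono Icc_subset_Ici_self)
    (fun t ht => (hy' t ht.1).mono (Ici_subset_Ici.2 ht.1))
    (fun t ht => by simp) (fun t ht => hys _ (sub_nonneg.2 ht.1)) (by simp [hy0]) t ht
  rw [dist_eq_norm, add_zero] at h
  exact h.trans (gronwallBound_zero_le (by exact_mod_cast hL) hε (by linarith [ht.2]))

/-- An origin that is globally exponentially stable for `ẋ = f(x)` is exponentially input-to-state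
stable for `ẋ = f(x) + u`, along trajectories in a region where `f` is Lipschitz. -/
theorem IsGloballyExpStableAtOrigin.exists_iss_bound {f : E → E}
    (hf : IsGloballyExpStableAtOrigin f) (L : ℝ≥0) :
    ∃ K ≥ 1, ∃ ν > 0, ∀ s : Set E, LipschitzOnWith L f s → ∀ (x u : ℝ → E) (b c ε : ℝ), 0 ≤ ε →
      (∀ t ∈ Icc b c, HasDerivWithinAt x (f (x t) + u t) (Icc b c) t) →
      (∀ t ∈ Icc b c, ‖u t‖ ≤ ε) → (∀ t ∈ Icc b c, x t ∈ s) →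
      closedBall 0 (K * (‖x b‖ + ε)) ⊆ s →
      ∀ t ∈ Icc b c, ‖x t‖ ≤ K * (Real.exp (-ν * (t - b)) * ‖x b‖ + ε) := by
  obtain ⟨hex, k₀, -, lam, hlam, hk₀⟩ := hf
  obtain ⟨k, hk1, hk⟩ : ∃ k ≥ 1, ∀ y : ℝ → E, IsForwardSolution f y → ∀ t, 0 ≤ t →
      ‖y t‖ ≤ k * ‖y 0‖ * Real.exp (-lam * t) := by
    refine ⟨max k₀ 1, le_max_right _ _, fun y hy t ht => (hk₀ y hy t ht).trans ?_⟩
    gcongr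
    exact le_max_left _ _
  have hlog : 0 < Real.log (2 * k) := Real.log_pos (by linarith)
  have hlog2 : 0 < Real.log 2 := Real.log_pos (by norm_num)
  -- The time after which the unperturbed decay estimate has factor 1/2.
  set T := Real.log (2 * k) / lam with hT
  have hTpos : 0 < T := by positivity
  have hkT : k * Real.exp (-lam * T) = 1 / 2 := by
    have : -lam * T = -Real.log (2 * k) := by rw [hT]; field_simp
    rw [this, Real.exp_neg, Real.exp_log (by linarith)]
    field_simp
  set C := Real.exp (((L + 1 : ℝ≥0) : ℝ) * T) with hC
  have hCpos : 0 < C := Real.exp_pos _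
  -- The final estimate is `2 * k * e * ‖x b‖ + (2 * k + 1) * C * ε`; the constant dominates both
  -- coefficients.
  refine ⟨2 * k + (2 * k + 1) * C, by nlinarith, Real.log 2 / T, by positivity, ?_⟩
  intro s hs x u b c ε hε hx hu hxs hball
  have hkC : 0 < k * C := by positivity
  -- one step of length at most `T`
  have step : ∀ a ∈ Icc b c, ‖x a‖ ≤ ‖x b‖ + 2 * C * ε → ∀ t ∈ Icc a c, t ≤ a + T →
      ‖x t‖ ≤ k * Real.exp (-lam * (t - a)) * ‖x a‖ + C * ε := by
    intro a ha hxa t ht htT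
    obtain ⟨y, hy, hy0⟩ := hex (x a)
    have hsub : Icc a t ⊆ Icc b c := Icc_subset_Icc ha.1 ht.2
    -- The ball hypothesis serves to keep the comparison solution in the Lipschitz region.
    have hys : ∀ r, 0 ≤ r → y r ∈ s := by
      intro r hr
      refine hball (mem_closedBall_zero_iff.2 ((hk y hy r hr).trans ?_))
      have h1 : Real.exp (-lam * r) ≤ 1 := Real.exp_le_one_iff.2 (by nlinarith)
      rw [hy0]
      have h2 : k * ‖x a‖ * Real.exp (-lam * r) ≤ k * ‖x a‖ :=
        mul_le_of_le_one_right (by positivity) h1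
      have h3 : k * ‖x a‖ ≤ k * (‖x b‖ + 2 * C * ε) := by gcongr
      have : 0 ≤ k * ‖x b‖ + (k * C) * ‖x b‖ + C * ‖x b‖ + k * ε + C * ε + k * C * ‖x b‖ + k * ε := by
        positivity
      nlinarith
    -- `L + 1` replaces `L` to meet the requirement of a constant at least 1.
    have h := dist_le_of_perturbed_trajectory (L := L + 1) (by simp) (hs.weaken (by simp))
      (c := t) (T := T) (by linarith) hε
      (fun r hr => (hx r (hsub hr)).mono hsub) (fun r hr => hu r (hsub hr))
      (fun r hr => hxs r (hsub hr)) hy hys hy0 t ⟨ht.1, le_rfl⟩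
    have h1 := hk y hy (t - a) (sub_nonneg.2 ht.1)
    rw [hy0] at h1
    have h2 := norm_le_norm_sub_add (x t) (y (t - a))
    linarith
  -- `2 * C * ε` is the fixed point of `r ↦ r / 2 + C * ε`.
  have iter : ∀ n : ℕ, b + n * T ≤ c → ‖x (b + n * T)‖ ≤ (1 / 2) ^ n * ‖x b‖ + 2 * C * ε := by
    intro n
    induction n with
    | zero =>
      intro _
      have : 0 ≤ C * ε := by positivity
      simp
      linarith
    | succ n ih =>
      intro hn
      push_cast at hn
      have hn' : b + n * T ≤ c := by linarith
      have hpos : 0 ≤ n * T := by positivity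
      have hle : ((1 : ℝ) / 2) ^ n ≤ 1 := pow_le_one₀ (by norm_num) (by norm_num)
      have h0 := ih hn'
      have h := step (b + n * T) ⟨by linarith, hn'⟩
        (h0.trans (by gcongr; exact mul_le_of_le_one_left (norm_nonneg _) hle))
        (b + n * T + T) ⟨by linarith, by linarith⟩ le_rfl
      rw [add_sub_cancel_left, hkT] at h
      have e : b + ((n + 1 : ℕ) : ℝ) * T = b + n * T + T := by push_cast; ring
      rw [e, pow_succ]
      linarith
  intro t ht
  have htb : 0 ≤ t - b := sub_nonneg.2 ht.1
  set n := ⌊(t - b) / T⌋₊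
  have hn1 : n * T ≤ t - b := (le_div_iff₀ hTpos).1 (Nat.floor_le (by positivity))
  have hn2 : t - b < (n + 1) * T := (div_lt_iff₀ hTpos).1 (Nat.lt_floor_add_one _)
  -- Rounding down to whole windows costs the factor 2.
  have hpow : ((1 : ℝ) / 2) ^ n ≤ 2 * Real.exp (-(Real.log 2 / T) * (t - b)) := by
    have h1 : ((1 : ℝ) / 2) ^ n = Real.exp (-(Real.log 2) * n) := by
      rw [mul_comm, Real.exp_nat_mul, Real.exp_neg, Real.exp_log (by norm_num)]
      norm_num
    have h2 : (2 : ℝ) * Real.exp (-(Real.log 2 / T) * (t - b))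
        = Real.exp (Real.log 2 + -(Real.log 2 / T) * (t - b)) := by
      rw [Real.exp_add, Real.exp_log (by norm_num)]
    rw [h1, h2, Real.exp_le_exp]
    have h3 : Real.log 2 / T * (t - b) ≤ Real.log 2 / T * ((n + 1) * T) := by gcongr
    have h4 : Real.log 2 / T * ((n + 1) * T) = Real.log 2 * (n + 1) := by field_simp
    linarith
  have hpos : 0 ≤ n * T := by positivity
  have h0 := iter n (by linarith [ht.2])
  have hle : ((1 : ℝ) / 2) ^ n ≤ 1 := pow_le_one₀ (by norm_num) (by norm_num)
  have h := step (b + n * T) ⟨by linarith, by linarith [ht.2]⟩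
    (h0.trans (by gcongr; exact mul_le_of_le_one_left (norm_nonneg _) hle))
    t ⟨by linarith, ht.2⟩ (by linarith)
  set e := Real.exp (-(Real.log 2 / T) * (t - b))
  have he : 0 < e := Real.exp_pos _
  have h5 : k * Real.exp (-lam * (t - (b + n * T))) * ‖x (b + n * T)‖ ≤
      k * (2 * e * ‖x b‖ + 2 * C * ε) := by
    have h6 : Real.exp (-lam * (t - (b + n * T))) ≤ 1 :=
      Real.exp_le_one_iff.2 (by nlinarith)
    calc _ ≤ k * 1 * ((1 / 2) ^ n * ‖x b‖ + 2 * C * ε) := by gcongr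
      _ ≤ _ := by rw [mul_one]; gcongr
  have : 0 ≤ (2 * k + 1) * C * (e * ‖x b‖) + 2 * k * ε := by positivity
  nlinarith

end ISS

/-! ### Stability of the cascade -/

section Cascade

open Metric
open scoped NNReal

/-- Restart once `‖u‖ ≤ ε`: the initial term dies out and leaves `K * ε`, at most `e / 2`. The cap
`ε₀` admits bounds valid only for small inputs. -/
theorem tendsto_zero_of_iss {E F : Type*} [NormedAddCommGroup E] [NormedAddCommGroup F]
    {x : ℝ → E} {u : ℝ → F} {K ν ε₀ : ℝ} (hK : 1 ≤ K) (hν : 0 < ν) (hε₀ : 0 < ε₀)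
    (h : ∀ b, 0 ≤ b → ∀ ε, 0 < ε → ε ≤ ε₀ → (∀ t, b ≤ t → ‖u t‖ ≤ ε) →
      ∀ t, b ≤ t → ‖x t‖ ≤ K * (Real.exp (-ν * (t - b)) * ‖x b‖ + ε))
    (hu : Tendsto u atTop (𝓝 0)) : Tendsto x atTop (𝓝 0) := by
  rw [NormedAddGroup.tendsto_nhds_zero]
  intro e he
  have hε : 0 < min ε₀ (e / (2 * K)) := lt_min hε₀ (by positivity)
  obtain ⟨b₀, hb₀⟩ := eventually_atTop.1 (NormedAddGroup.tendsto_nhds_zero.1 hu _ hε)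
  have hb := h (max b₀ 0) (le_max_right _ _) _ hε (min_le_left _ _)
    (fun t ht => (hb₀ t ((le_max_left _ _).trans ht)).le)
  set b := max b₀ 0
  set ε := min ε₀ (e / (2 * K))
  have hlim : Tendsto (fun t => K * (Real.exp (-ν * (t - b)) * ‖x b‖ + ε)) atTop
      (𝓝 (K * (0 * ‖x b‖ + ε))) := by
    refine (((Real.tendsto_exp_atBot.comp ?_).mul_const _).add_const _).const_mul _
    exact (tendsto_atTop_add_const_right _ (-b) tendsto_id).const_mul_atTop_of_neg (by linarith)
  have hlt : K * (0 * ‖x b‖ + ε) < e := by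
    have : K * ε ≤ K * (e / (2 * K)) := by gcongr; exact min_le_right _ _
    have h2 : K * (e / (2 * K)) = e / 2 := by field_simp
    linarith
  filter_upwards [hlim.eventually_lt_const hlt, eventually_ge_atTop b] with t ht hbt
  exact (hb t hbt).trans_lt ht

variable {n₁ n₂ : ℕ} {f₁ : EuclideanSpace ℝ (Fin n₁) → EuclideanSpace ℝ (Fin n₁)}
  {f₂ : EuclideanSpace ℝ (Fin n₂) → EuclideanSpace ℝ (Fin n₂)}
  {g : EuclideanSpace ℝ (Fin n₁) → EuclideanSpace ℝ (Fin n₂) → EuclideanSpace ℝ (Fin n₁)}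

theorem CascadeState.norm_le (x : CascadeState n₁ n₂) : ‖x‖ ≤ ‖x.fst‖ + ‖x.snd‖ := by
  have h := WithLp.prod_norm_sq_eq_of_L2 x
  refine abs_le_of_sq_le_sq' ?_ (by positivity) |>.2
  nlinarith [norm_nonneg x.fst, norm_nonneg x.snd]

theorem CascadeState.tendsto_zero {x : ℝ → CascadeState n₁ n₂}
    (h₁ : Tendsto (fun t => (x t).fst) atTop (𝓝 0))
    (h₂ : Tendsto (fun t => (x t).snd) atTop (𝓝 0)) : Tendsto x atTop (𝓝 0) := by
  refine squeeze_zero_norm (fun t => CascadeState.norm_le (x t)) ?_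
  simpa using h₁.norm.add h₂.norm

theorem locallyLipschitz_cascadeField (hf₁ : LocallyLipschitz f₁) (hf₂ : LocallyLipschitz f₂)
    (hg : LocallyLipschitz
      (fun p : EuclideanSpace ℝ (Fin n₁) × EuclideanSpace ℝ (Fin n₂) => g p.1 p.2)) :
    LocallyLipschitz (cascadeField f₁ f₂ g) := by
  have hfst : LocallyLipschitz (fun x : CascadeState n₁ n₂ => x.fst) :=
    (WithLp.fstL 2 ℝ (EuclideanSpace ℝ (Fin n₁)) (EuclideanSpace ℝ (Fin n₂))).lipschitz
      |>.locallyLipschitz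
  have hsnd : LocallyLipschitz (fun x : CascadeState n₁ n₂ => x.snd) :=
    (WithLp.sndL 2 ℝ (EuclideanSpace ℝ (Fin n₁)) (EuclideanSpace ℝ (Fin n₂))).lipschitz
      |>.locallyLipschitz
  have hadd : LocallyLipschitz
      (fun p : EuclideanSpace ℝ (Fin n₁) × EuclideanSpace ℝ (Fin n₁) => p.1 + p.2) :=
    (ContinuousLinearMap.fst ℝ (EuclideanSpace ℝ (Fin n₁)) (EuclideanSpace ℝ (Fin n₁)) +
      ContinuousLinearMap.snd ℝ _ _).lipschitz.locallyLipschitz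
  have hsum := hadd.comp ((hf₁.comp hfst).prodMk (hg.comp (hfst.prodMk hsnd)))
  exact (WithLp.prodContinuousLinearEquiv 2 ℝ (EuclideanSpace ℝ (Fin n₁))
    (EuclideanSpace ℝ (Fin n₂))).symm.lipschitz.locallyLipschitz.comp (hsum.prodMk (hf₂.comp hsnd))

theorem IsIntegralCurveOn.cascade_fst {x : ℝ → CascadeState n₁ n₂} {S : Set ℝ}
    (hx : IsIntegralCurveOn x (fun _ => cascadeField f₁ f₂ g) S) :
    ∀ t ∈ S, HasDerivWithinAt (fun t => (x t).fst)
      (f₁ (x t).fst + g (x t).fst (x t).snd) S t := fun t ht =>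
  (WithLp.fstL 2 ℝ (EuclideanSpace ℝ (Fin n₁)) (EuclideanSpace ℝ (Fin n₂))).hasFDerivAt
    |>.comp_hasDerivWithinAt t (hx t ht)

theorem IsIntegralCurveOn.cascade_snd {x : ℝ → CascadeState n₁ n₂} {S : Set ℝ}
    (hx : IsIntegralCurveOn x (fun _ => cascadeField f₁ f₂ g) S) :
    IsIntegralCurveOn (fun t => (x t).snd) (fun _ => f₂) S := fun t ht =>
  (WithLp.sndL 2 ℝ (EuclideanSpace ℝ (Fin n₁)) (EuclideanSpace ℝ (Fin n₂))).hasFDerivAt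
    |>.comp_hasDerivWithinAt t (hx t ht)

/-- While `x₁` is in the unit ball, the input-to-state bound places it in the ball of radius `m / 4
< 1`, so it never leaves. -/
theorem IsStableAtOrigin.cascade (hf₁ : LocallyLipschitz f₁) (hf₂ : LocallyLipschitz f₂)
    (hg : LocallyLipschitz
      (fun p : EuclideanSpace ℝ (Fin n₁) × EuclideanSpace ℝ (Fin n₂) => g p.1 p.2))
    (hexp : IsGloballyExpStableAtOrigin f₁) {M : ℝ} (hM : 0 < M)
    (hgM : ∀ x₁ x₂, ‖g x₁ x₂‖ ≤ M * ‖x₂‖) (hst : IsStableAtOrigin f₂) :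
    IsStableAtOrigin (cascadeField f₁ f₂ g) := by
  obtain ⟨L, hL⟩ := hf₁.exists_lipschitzOnWith_closedBall 0 1
  obtain ⟨K, hK, ν, hν, hiss⟩ := hexp.exists_iss_bound L
  intro ε hε
  obtain ⟨m, hm, hmε, hm1⟩ : ∃ m > 0, m ≤ ε ∧ m ≤ 1 :=
    ⟨min ε 1, lt_min hε one_pos, min_le_left _ _, min_le_right _ _⟩
  obtain ⟨η, hη, hηm⟩ : ∃ η > 0, K * (η + M * η) = m / 4 :=
    ⟨m / (4 * (K * (1 + M))), by positivity, by field_simp⟩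
  have hηm' : η ≤ m / 4 := by
    have : 0 ≤ K * (M * η) := by positivity
    nlinarith
  obtain ⟨δ, hδ, hδη⟩ := hst η hη
  refine ⟨min δ η, lt_min hδ hη, fun x₀ hx₀ => ?_⟩
  have hx₀δ := hx₀.trans_le (min_le_left _ _)
  have hx₀η := hx₀.trans_le (min_le_right _ _)
  obtain ⟨⟨y, hy, hy0⟩, hbd⟩ := hδη x₀.snd ((WithLp.norm_snd_le _ _).trans_lt hx₀δ)
  -- Stated on `[0, τ]` so that it yields both existence and stability.
  have key : ∀ τ, 0 ≤ τ → ∀ x : ℝ → CascadeState n₁ n₂,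
      IsIntegralCurveOn x (fun _ => cascadeField f₁ f₂ g) (Icc 0 τ) → x 0 = x₀ → ‖x τ‖ < m := by
    intro τ hτ x hx hx0
    have h2 : ∀ t ∈ Icc 0 τ, ‖(x t).snd‖ ≤ η := by
      intro t ht
      have := hx.cascade_snd.eqOn_Icc_of_locallyLipschitz hf₂ (hy.mono Icc_subset_Ici_self)
        (by simp [hx0, hy0]) ht
      dsimp only at this
      rw [this]
      exact (hbd y hy hy0 t ht.1).le
    have h10 : ‖(x 0).fst‖ < η := by
      rw [hx0]
      exact (WithLp.norm_fst_le _ _).trans_lt hx₀η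
    have hb : ∀ σ ∈ Icc 0 τ, (∀ t ∈ Icc 0 σ, ‖(x t).fst‖ ≤ 1) → ‖(x σ).fst‖ ≤ m / 4 := by
      intro σ hσ h1
      have hsub : Icc 0 σ ⊆ Icc 0 τ := Icc_subset_Icc_right hσ.2
      have hle : K * (‖(x 0).fst‖ + M * η) ≤ m / 4 := by rw [← hηm]; gcongr
      have h := hiss _ hL (fun t => (x t).fst) (fun t => g (x t).fst (x t).snd) 0 σ (M * η)
        (by positivity) (hx.mono hsub).cascade_fst
        (fun t ht => (hgM _ _).trans (by gcongr; exact h2 t (hsub ht)))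
        (fun t ht => mem_closedBall_zero_iff.2 (h1 t ht))
        (closedBall_subset_closedBall (by linarith)) σ ⟨hσ.1, le_rfl⟩
      refine h.trans (le_trans ?_ hle)
      gcongr
      exact mul_le_of_le_one_left (norm_nonneg _)
        (Real.exp_le_one_iff.2 (by nlinarith [hσ.1]))
    have hlt := forall_lt_of_no_first_exit (φ := fun t => ‖(x t).fst‖) (τ := τ) (R := 1)
      (fun t ht => (hx.cascade_fst t ht).continuousWithinAt.norm) (by linarith)
      (fun σ hσ h1 => by linarith [hb σ hσ h1])
    have h1 := hb τ ⟨hτ, le_rfl⟩ fun t ht => (hlt t ht).le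
    linarith [CascadeState.norm_le (x τ), h2 τ ⟨hτ, le_rfl⟩]
  refine ⟨?_, fun x hx hx0 t ht => (key t ht x (hx.mono Icc_subset_Ici_self) hx0).trans_le hmε⟩
  exact exists_isForwardSolution_of_apriori_bound (locallyLipschitz_cascadeField hf₁ hf₂ hg)
    fun T hT => ⟨m, fun τ hτ x hx hx0 => (key τ hτ.1 x hx hx0).le⟩

/-- Stability confines `x₁` to the region where the local bound can be restarted at any time. -/
theorem IsAsympStableAtOrigin.cascade (hf₁ : LocallyLipschitz f₁) (hf₂ : LocallyLipschitz f₂)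
    (hg : LocallyLipschitz
      (fun p : EuclideanSpace ℝ (Fin n₁) × EuclideanSpace ℝ (Fin n₂) => g p.1 p.2))
    (hexp : IsGloballyExpStableAtOrigin f₁) {M : ℝ} (hM : 0 < M)
    (hgM : ∀ x₁ x₂, ‖g x₁ x₂‖ ≤ M * ‖x₂‖) (hst : IsAsympStableAtOrigin f₂) :
    IsAsympStableAtOrigin (cascadeField f₁ f₂ g) := by
  have hstab := hst.1.cascade hf₁ hf₂ hg hexp hM hgM
  refine ⟨hstab, ?_⟩
  obtain ⟨L, hL⟩ := hf₁.exists_lipschitzOnWith_closedBall 0 1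
  obtain ⟨K, hK, ν, hν, hiss⟩ := hexp.exists_iss_bound L
  -- Makes the ball required by the bound fit in the unit ball.
  obtain ⟨η, hη, hη1⟩ : ∃ η > 0, K * (η + M * η) = 1 :=
    ⟨1 / (K * (1 + M)), by positivity, by field_simp⟩
  have hη1' : η ≤ 1 := by
    have : 0 ≤ K * (M * η) := by positivity
    nlinarith
  obtain ⟨δ₁, hδ₁, h₁⟩ := hstab η hη
  obtain ⟨δ₂, hδ₂, h₂⟩ := hst.2
  refine ⟨min δ₁ δ₂, lt_min hδ₁ hδ₂, fun x hx hx0 => ?_⟩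
  have hxη := (h₁ (x 0) (hx0.trans_le (min_le_left _ _))).2 x hx rfl
  have hx1 : ∀ t, 0 ≤ t → ‖(x t).fst‖ ≤ η := fun t ht =>
    (WithLp.norm_fst_le _ _).trans (hxη t ht).le
  have hx2 := h₂ _ hx.cascade_snd
    ((WithLp.norm_snd_le _ _).trans_lt (hx0.trans_le (min_le_right _ _)))
  refine CascadeState.tendsto_zero (tendsto_zero_of_iss (u := fun t => g (x t).fst (x t).snd) hK hν
    (mul_pos hM hη) ?_ (squeeze_zero_norm (fun t => hgM _ _) (by simpa using hx2.norm.const_mul M)))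
    hx2
  intro b hb ε hε hεη hu t ht
  have hsub : Icc b t ⊆ Ici 0 := fun r hr => hb.trans hr.1
  refine hiss _ hL (fun t => (x t).fst) (fun t => g (x t).fst (x t).snd) b t ε
    hε.le (hx.mono hsub).cascade_fst (fun r hr => hu r hr.1)
    (fun r hr => mem_closedBall_zero_iff.2 ((hx1 r (hsub hr)).trans hη1'))
    (closedBall_subset_closedBall ?_) t ⟨ht, le_rfl⟩
  rw [← hη1]
  have := hx1 b hb
  gcongr

/-- If `f₁` is globally Lipschitz, the first component of the cascade is globally exponentially
input-to-state stable with respect to the second one. -/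
theorem IsGloballyExpStableAtOrigin.exists_cascade_iss_bound
    (hexp : IsGloballyExpStableAtOrigin f₁) {M : ℝ} (hM : 0 < M)
    (hgM : ∀ x₁ x₂, ‖g x₁ x₂‖ ≤ M * ‖x₂‖) {L : ℝ≥0} (hL : LipschitzWith L f₁) :
    ∃ K ≥ 1, ∃ ν > 0, ∀ (x : ℝ → CascadeState n₁ n₂) (b c ε : ℝ), 0 ≤ ε →
      IsIntegralCurveOn x (fun _ => cascadeField f₁ f₂ g) (Icc b c) →
      (∀ t ∈ Icc b c, ‖(x t).snd‖ ≤ ε) →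
      ∀ t ∈ Icc b c, ‖(x t).fst‖ ≤ K * (Real.exp (-ν * (t - b)) * ‖(x b).fst‖ + M * ε) := by
  obtain ⟨K, hK, ν, hν, hiss⟩ := hexp.exists_iss_bound L
  refine ⟨K, hK, ν, hν, fun x b c ε hε hx hx2 => ?_⟩
  exact hiss univ hL.lipschitzOnWith (fun t => (x t).fst) (fun t => g (x t).fst (x t).snd) b c
    (M * ε) (by positivity) hx.cascade_fst
    (fun t ht => (hgM _ _).trans (by gcongr; exact hx2 t ht)) (fun _ _ => mem_univ _)
    (subset_univ _)

/-- By uniqueness `x₂` follows a global solution, hence is bounded on `[0, T]`; the input-to-state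
bound then controls `x₁`. -/
theorem exists_isForwardSolution_cascade (hf₁ : LocallyLipschitz f₁) (hf₂ : LocallyLipschitz f₂)
    (hg : LocallyLipschitz
      (fun p : EuclideanSpace ℝ (Fin n₁) × EuclideanSpace ℝ (Fin n₂) => g p.1 p.2))
    (hexp : IsGloballyExpStableAtOrigin f₁) {M : ℝ} (hM : 0 < M)
    (hgM : ∀ x₁ x₂, ‖g x₁ x₂‖ ≤ M * ‖x₂‖) {L : ℝ≥0} (hL : LipschitzWith L f₁)
    (hex : ∀ y₀, ∃ y : ℝ → EuclideanSpace ℝ (Fin n₂), IsForwardSolution f₂ y ∧ y 0 = y₀)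
    (x₀ : CascadeState n₁ n₂) :
    ∃ x : ℝ → CascadeState n₁ n₂, IsForwardSolution (cascadeField f₁ f₂ g) x ∧ x 0 = x₀ := by
  obtain ⟨K, hK, ν, hν, hiss⟩ := hexp.exists_cascade_iss_bound (f₂ := f₂) hM hgM hL
  refine exists_isForwardSolution_of_apriori_bound (locallyLipschitz_cascadeField hf₁ hf₂ hg)
    fun T hT => ?_
  obtain ⟨y, hy, hy0⟩ := hex x₀.snd
  obtain ⟨R, hR⟩ := IsIntegralCurveOn.exists_norm_le_Icc
    (hy.mono (Icc_subset_Ici_self : Icc 0 T ⊆ Ici 0))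
  have hR0 : 0 ≤ R := (norm_nonneg _).trans (hR 0 ⟨le_rfl, hT⟩)
  refine ⟨K * (‖x₀.fst‖ + M * R) + R, fun τ hτ x hx hx0 => ?_⟩
  have h2 : ∀ t ∈ Icc 0 τ, ‖(x t).snd‖ ≤ R := by
    intro t ht
    have := hx.cascade_snd.eqOn_Icc_of_locallyLipschitz hf₂ (hy.mono Icc_subset_Ici_self)
      (by simp [hx0, hy0]) ht
    dsimp only at this
    rw [this]
    exact hR t ⟨ht.1, ht.2.trans hτ.2⟩
  have h1 := hiss x 0 τ R hR0 hx h2 τ ⟨hτ.1, le_rfl⟩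
  refine (CascadeState.norm_le _).trans (add_le_add (h1.trans ?_) (h2 τ ⟨hτ.1, le_rfl⟩))
  rw [hx0]
  gcongr
  exact mul_le_of_le_one_left (norm_nonneg _) (Real.exp_le_one_iff.2 (by nlinarith [hτ.1]))

theorem IsGloballyAsympStableAtOrigin.cascade (hf₁ : LocallyLipschitz f₁)
    (hf₂ : LocallyLipschitz f₂)
    (hg : LocallyLipschitz
      (fun p : EuclideanSpace ℝ (Fin n₁) × EuclideanSpace ℝ (Fin n₂) => g p.1 p.2))
    (hexp : IsGloballyExpStableAtOrigin f₁) {M : ℝ} (hM : 0 < M)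
    (hgM : ∀ x₁ x₂, ‖g x₁ x₂‖ ≤ M * ‖x₂‖) {L : ℝ≥0} (hL : LipschitzWith L f₁)
    (hst : IsGloballyAsympStableAtOrigin f₂) :
    IsGloballyAsympStableAtOrigin (cascadeField f₁ f₂ g) := by
  refine ⟨hst.1.cascade hf₁ hf₂ hg hexp hM hgM,
    exists_isForwardSolution_cascade hf₁ hf₂ hg hexp hM hgM hL hst.2.1, fun x hx => ?_⟩
  obtain ⟨K, hK, ν, hν, hiss⟩ := hexp.exists_cascade_iss_bound (f₂ := f₂) hM hgM hL
  have hx2 := hst.2.2 _ hx.cascade_snd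
  -- The bound holds for inputs of any size, so the cap 1 is arbitrary.
  refine CascadeState.tendsto_zero (tendsto_zero_of_iss (u := fun t => M • (x t).snd)
    hK hν one_pos ?_ (by simpa using hx2.const_smul M)) hx2
  intro b hb ε hε _ hu t ht
  have h := hiss x b t (ε / M) (by positivity) (hx.mono fun r hr => hb.trans hr.1)
    (fun r hr => ?_) t ⟨ht, le_rfl⟩
  · rwa [mul_div_cancel₀ _ hM.ne'] at h
  · have := hu r hr.1
    rw [norm_smul, Real.norm_of_nonneg hM.le] at this
    exact (le_div_iff₀' hM).2 this

/-- On `[0, t/2]` boundedness of `x₁` suffices; on `[t/2, t]` its initial term decays and the input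
is already of order `exp (-μ * t / 2)`. Hence the rate `min ν μ / 2`. -/
theorem IsGloballyExpStableAtOrigin.cascade (hf₁ : LocallyLipschitz f₁)
    (hf₂ : LocallyLipschitz f₂)
    (hg : LocallyLipschitz
      (fun p : EuclideanSpace ℝ (Fin n₁) × EuclideanSpace ℝ (Fin n₂) => g p.1 p.2))
    (hexp : IsGloballyExpStableAtOrigin f₁) {M : ℝ} (hM : 0 < M)
    (hgM : ∀ x₁ x₂, ‖g x₁ x₂‖ ≤ M * ‖x₂‖) {L : ℝ≥0} (hL : LipschitzWith L f₁)
    (hst : IsGloballyExpStableAtOrigin f₂) :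
    IsGloballyExpStableAtOrigin (cascadeField f₁ f₂ g) := by
  refine ⟨exists_isForwardSolution_cascade hf₁ hf₂ hg hexp hM hgM hL hst.1, ?_⟩
  obtain ⟨-, k, hk, μ, hμ, hdec⟩ := hst
  obtain ⟨K, hK, ν, hν, hiss⟩ := hexp.exists_cascade_iss_bound (f₂ := f₂) hM hgM hL
  refine ⟨K * (K * (1 + M * k) + M * k) + k, by positivity, min ν μ / 2, by positivity,
    fun x hx t ht => ?_⟩
  set D := ‖x 0‖
  have hx2 : ∀ r, 0 ≤ r → ‖(x r).snd‖ ≤ k * D * Real.exp (-μ * r) := by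
    intro r hr
    refine (hdec _ hx.cascade_snd r hr).trans ?_
    gcongr
    exact WithLp.norm_snd_le _ _
  have hhalf : ‖(x (t / 2)).fst‖ ≤ K * (1 + M * k) * D := by
    refine (hiss x 0 (t / 2) (k * D) (by positivity) (hx.mono Icc_subset_Ici_self)
      (fun r hr => (hx2 r hr.1).trans (mul_le_of_le_one_right (by positivity)
        (Real.exp_le_one_iff.2 (by nlinarith [hr.1])))) (t / 2) ⟨by linarith, le_rfl⟩).trans ?_
    have h1 : Real.exp (-ν * (t / 2 - 0)) ≤ 1 := Real.exp_le_one_iff.2 (by nlinarith)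
    have h2 : ‖(x 0).fst‖ ≤ D := WithLp.norm_fst_le _ _
    calc _ ≤ K * (1 * D + M * (k * D)) := by gcongr
      _ = _ := by ring
  have h := hiss x (t / 2) t (k * D * Real.exp (-μ * (t / 2))) (by positivity)
    (hx.mono fun r hr => mem_Ici.2 (by linarith [hr.1]))
    (fun r hr => (hx2 r (by linarith [hr.1])).trans (by
      have : -μ * r ≤ -μ * (t / 2) := by nlinarith [hr.1]
      gcongr)) t ⟨by linarith, le_rfl⟩
  set e := Real.exp (-(min ν μ / 2) * t)
  have he1 : Real.exp (-ν * (t - t / 2)) ≤ e :=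
    Real.exp_le_exp.2 (by nlinarith [min_le_left ν μ])
  have he2 : Real.exp (-μ * (t / 2)) ≤ e := Real.exp_le_exp.2 (by nlinarith [min_le_right ν μ])
  have he3 : Real.exp (-μ * t) ≤ e := Real.exp_le_exp.2 (by nlinarith [min_le_right ν μ])
  calc ‖x t‖ ≤ ‖(x t).fst‖ + ‖(x t).snd‖ := CascadeState.norm_le _
    _ ≤ K * (e * (K * (1 + M * k) * D) + M * (k * D * e)) + k * D * e :=
        add_le_add (h.trans (by gcongr)) ((hx2 t ht).trans (by gcongr))
    _ = _ := by ring

end Cascade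

theorem mainTheorem9 (n₁ n₂ : ℕ)
    (f₁ : EuclideanSpace ℝ (Fin n₁) → EuclideanSpace ℝ (Fin n₁))
    (f₂ : EuclideanSpace ℝ (Fin n₂) → EuclideanSpace ℝ (Fin n₂))
    (g : EuclideanSpace ℝ (Fin n₁) → EuclideanSpace ℝ (Fin n₂) → EuclideanSpace ℝ (Fin n₁))
    (hf₁ : LocallyLipschitz f₁) (hf₂ : LocallyLipschitz f₂)
    (hg : LocallyLipschitz
      (fun p : EuclideanSpace ℝ (Fin n₁) × EuclideanSpace ℝ (Fin n₂) => g p.1 p.2))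
    (hexp : IsGloballyExpStableAtOrigin f₁)
    (M : ℝ) (hM : 0 < M) (hgM : ∀ x₁ x₂, ‖g x₁ x₂‖ ≤ M * ‖x₂‖) :
    (IsAsympStableAtOrigin f₂ → IsAsympStableAtOrigin (cascadeField f₁ f₂ g)) ∧
    ((∃ L, LipschitzWith L f₁) →
      (IsGloballyAsympStableAtOrigin f₂ →
        IsGloballyAsympStableAtOrigin (cascadeField f₁ f₂ g)) ∧
      (IsGloballyExpStableAtOrigin f₂ →
        IsGloballyExpStableAtOrigin (cascadeField f₁ f₂ g))) := by
  refine ⟨fun h => h.cascade hf₁ hf₂ hg hexp hM hgM, ?_⟩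
  rintro ⟨L, hL⟩
  exact ⟨fun h => h.cascade hf₁ hf₂ hg hexp hM hgM hL,
    fun h => hexp.cascade hf₁ hf₂ hg hM hgM hL h⟩
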